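/- Let $G=\langle a,b,c,d \mid aba^{-1}dcd^{-1}\rangle$, a finitely presented group, and let $\Gamma$ be its Cayley graph with respect to the generators $a,b,c,d$ (vertices $g\in G$; edges $\{g,gs\}$ for $s\in\{a,b,c,d\}^{\pm1}$), with graph metric $d_\Gamma$ on the vertex set $G$. A path is minimal if its length equals the distance between its endpoints, and a path is described by its starting vertex and the word that labels its edges. 1. For every integer $n\ge 0$ we have $ab^na^{-1}=dc^{-n}d^{-1}$; the only minimal path in $\Gamma$ from $a$ to $ab^na^{-1}$ is $b^na^{-1}$; the only minimal path from $d$ to $ab^na^{-1}$ is $c^{-n}d^{-1}$; and the triple $\{a,\,ab^na^{-1},\,d\}$ has perimeter $d_\Gamma(a,ab^na^{-1})+d_\Gamma(ab^na^{-1},d)+d_\Gamma(d,a)=2n+4$. 2. The metric boundary of $(G,d_\Gamma)$ contains a point that is not a Busemann point. Here, for a complete, locally compact metric space $(X,\rho)$, let $\mathcal G(X,\rho)$ be the closed subalgebra of the algebra $C_b(X)$ of bounded continuous complex functions generated by the functions vanishing at infinity, the constants, and the functions $x\mapsto \rho(x,y)-\rho(x,z)$ for $y,z\in X$. The metric compactification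 $\overline X_\rho$ is the maximal ideal space (space of characters) of $\mathcal G(X,\rho)$; $X$ is regarded as a subset of it by point evaluations, and the metric boundary is $\overline X_\rho\setminus X$. An almost-geodesic ray is a map $\gamma:T\to X$, where $T\subseteq[0,\infty)$ is unbounded and contains $0$, such that for every $\varepsilon>0$ there is an integer $N$ with $|\rho(\gamma(t),\gamma(s))+\rho(\gamma(s),\gamma(0))-t|<\varepsilon$ for all $t,s\in T$ with $t\ge s\ge N$. A Busemann point is a point of the metric boundary that is the limit, in $\overline X_\rho$, of an almost-geodesic ray. -/

import Mathlib

open Filter Topology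
open scoped BoundedContinuousFunction

noncomputable section

namespace MetricCompact

/-! ### The metric compactification and Busemann points -/

section Compactification

/-- The bounded continuous function `φ_{y,z}(x) = d(x,y) - d(x,z)`. -/
def phi {X : Type*} [MetricSpace X] (y z : X) : X →ᵇ ℂ :=
  BoundedContinuousFunction.ofNormedAddCommGroup
    (fun x => ((dist x y - dist x z : ℝ) : ℂ)) (by fun_prop) (dist y z) (by
      intro x
      rw [Complex.norm_real, Real.norm_eq_abs, dist_comm x y, dist_comm x z]
      exact abs_dist_sub_le y z x)

/-- The closed (unital, star-) subalgebra `𝒢(X, d)` of `C_b(X)` generated by the functions that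
vanish at infinity, the constant functions, and the functions `φ_{y,z}`. -/
def metricAlgebra (X : Type*) [MetricSpace X] : StarSubalgebra ℂ (X →ᵇ ℂ) :=
  (StarAlgebra.adjoin ℂ
    ({f : X →ᵇ ℂ | Tendsto f (cocompact X) (𝓝 0)} ∪
      Set.range (BoundedContinuousFunction.const X : ℂ → X →ᵇ ℂ) ∪
      Set.range fun p : X × X => phi p.1 p.2)).topologicalClosure

instance (X : Type*) [MetricSpace X] : CompleteSpace (metricAlgebra X) :=
  (StarSubalgebra.isClosed_topologicalClosure _).completeSpace_coe

/-- The metric compactification: the maximal ideal space of `𝒢(X, d)`, that is, its space of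
characters with the weak-* topology. -/
abbrev Compactification (X : Type*) [MetricSpace X] : Type _ :=
  WeakDual.characterSpace ℂ (metricAlgebra X)

/-- The natural map `X → X̄_d`, sending a point `x` to the evaluation `f ↦ f x`. -/
def pointEval {X : Type*} [MetricSpace X] (x : X) : Compactification X :=
  WeakDual.CharacterSpace.equivAlgHom.symm
    (((ContinuousMap.evalAlgHom ℂ ℂ x).comp
      (BoundedContinuousFunction.toContinuousMapₐ ℂ)).comp
        (metricAlgebra X).toSubalgebra.val)

theorem pointEval_apply {X : Type*} [MetricSpace X] (x : X) (f : metricAlgebra X) :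
    pointEval x f = (f : X →ᵇ ℂ) x := rfl

/-- The metric boundary `∂_d X = X̄_d ∖ X`. -/
def metricBoundary (X : Type*) [MetricSpace X] : Set (Compactification X) :=
  (Set.range (pointEval : X → Compactification X))ᶜ

/-- `γ : T → X` is an almost-geodesic ray, where `T` is an unbounded subset of `[0, ∞)` that
contains `0`. -/
structure IsAlmostGeodesicRay {X : Type*} [MetricSpace X] (T : Set ℝ) (γ : T → X) : Prop where
  nonneg : ∀ t ∈ T, 0 ≤ t
  unbounded : ¬ BddAbove T
  zero_mem : (0 : ℝ) ∈ T
  almost_geodesic : ∀ ε > (0 : ℝ), ∃ N : ℤ, ∀ t s : T, (N : ℝ) ≤ s → (s : ℝ) ≤ t →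
    |dist (γ t) (γ s) + dist (γ s) (γ ⟨0, zero_mem⟩) - t| < ε

/-- A Busemann point: a point of the metric boundary that is the limit, in the metric
compactification, of an almost-geodesic ray. -/
def IsBusemannPoint {X : Type*} [MetricSpace X] (ω : Compactification X) : Prop :=
  ω ∈ metricBoundary X ∧ ∃ (T : Set ℝ) (γ : T → X), IsAlmostGeodesicRay T γ ∧
    Tendsto (fun t => pointEval (γ t)) atTop (𝓝 ω)

end Compactification

/-! ### Graph metrics and minimal paths -/

section Graphs

/-- The standard metric on the vertex set of a connected graph. -/
abbrev graphMetric {V : Type*} (Γ : SimpleGraph V) (h : Γ.Connected) : MetricSpace V where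
  dist x y := (Γ.dist x y : ℝ)
  dist_self x := by simp
  dist_comm x y := by simp [SimpleGraph.dist_comm]
  dist_triangle x y z := by exact_mod_cast h.dist_triangle
  eq_of_dist_eq_zero := by
    intro x y hxy
    exact h.dist_eq_zero_iff.1 (by exact_mod_cast hxy)

/-- A path is minimal if its length is the distance between its endpoints. -/
def IsMinimalPath {V : Type*} {Γ : SimpleGraph V} {x y : V} (p : Γ.Walk x y) : Prop :=
  p.length = Γ.dist x y

/-- The perimeter of a triple of vertices. -/
def perimeter {V : Type*} (Γ : SimpleGraph V) (x y z : V) : ℕ :=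
  Γ.dist x y + Γ.dist y z + Γ.dist z x

/-- The vertices `g, g s₁, g s₁ s₂, …, g s₁ ⋯ s_k` met by the path in a Cayley graph that starts
at `g` and is given by the word `s₁ ⋯ s_k`. -/
def pathVertices {G : Type*} [Group G] (g : G) (w : List G) : List G :=
  w.scanl (· * ·) g

/-- `w` is the only minimal path from `x` to `y`: the word `w` labels a minimal path from `x` to
`y`, and every minimal path from `x` to `y` is equal to that one. -/
def IsOnlyMinimalPath {G : Type*} [Group G] (Γ : SimpleGraph G) (x y : G) (w : List G) : Prop :=
  ∃ p : Γ.Walk x y, IsMinimalPath p ∧ p.support = pathVertices x w ∧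
    ∀ q : Γ.Walk x y, IsMinimalPath q → q = p

theorem mulCayley_connected {G : Type*} [Group G] (S : Set G) (hS : Subgroup.closure S = ⊤) :
    (SimpleGraph.mulCayley S).Connected := by
  have key : ∀ g : G, ∀ u : G, (SimpleGraph.mulCayley S).Reachable u (u * g) := by
    intro g
    have hg : g ∈ Subgroup.closure S := hS ▸ Subgroup.mem_top g
    induction hg using Subgroup.closure_induction with
    | mem s hs =>
      intro u
      by_cases h : u = u * s
      · rw [← h]
      · exact SimpleGraph.Adj.reachable
          ((SimpleGraph.mulCayley_adj' S u (u * s)).2 ⟨h, s, hs, Or.inl rfl⟩)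
    | one => intro u; rw [mul_one]
    | mul x y _ _ hx hy => intro u; rw [← mul_assoc]; exact (hx u).trans (hy (u * x))
    | inv x _ hx =>
      intro u
      have h := (hx (u * x⁻¹)).symm
      rwa [inv_mul_cancel_right] at h
  have : Nonempty G := ⟨1⟩
  exact ⟨fun u v => by simpa using key (u⁻¹ * v) u⟩

end Graphs

/-! ### The group `⟨a, b, c, d | a b a⁻¹ d c d⁻¹⟩` and its Cayley graph -/

section TheGroup

/-- The relator `a b a⁻¹ d c d⁻¹`, the letters `a, b, c, d` being `0, 1, 2, 3`. -/
def relator : FreeGroup (Fin 4) :=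
  FreeGroup.of 0 * FreeGroup.of 1 * (FreeGroup.of 0)⁻¹ *
    FreeGroup.of 3 * FreeGroup.of 2 * (FreeGroup.of 3)⁻¹

/-- The group `⟨a, b, c, d | a b a⁻¹ d c d⁻¹⟩`. -/
def ABCD : Type := PresentedGroup ({relator} : Set (FreeGroup (Fin 4)))

instance : Group ABCD := inferInstanceAs (Group (PresentedGroup {relator}))

/-- The canonical generators of the presented group. -/
def gen (i : Fin 4) : ABCD := PresentedGroup.of (rels := {relator}) i

/-- The generator `a`. -/
def gA : ABCD := gen 0

/-- The generator `b`. -/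
def gB : ABCD := gen 1

/-- The generator `c`. -/
def gC : ABCD := gen 2

/-- The generator `d`. -/
def gD : ABCD := gen 3

/-- The Cayley graph with respect to the generators `a, b, c, d`: the vertices `g` and `g s` are
joined for every `s ∈ {a, b, c, d}` (hence also for `s` the inverse of a generator). -/
def cayleyGraph : SimpleGraph ABCD := SimpleGraph.mulCayley {gA, gB, gC, gD}

theorem closure_generators : Subgroup.closure ({gA, gB, gC, gD} : Set ABCD) = ⊤ := by
  have h : Subgroup.closure (Set.range gen) = ⊤ :=
    PresentedGroup.closure_range_of ({relator} : Set (FreeGroup (Fin 4)))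
  rw [← top_le_iff, ← h]
  refine Subgroup.closure_mono ?_
  rintro _ ⟨i, rfl⟩
  fin_cases i <;> simp [gA, gB, gC, gD]

theorem cayleyGraph_connected : cayleyGraph.Connected :=
  mulCayley_connected _ closure_generators

/-- The group carries the graph metric of its Cayley graph. -/
instance : MetricSpace ABCD := graphMetric cayleyGraph cayleyGraph_connected

end TheGroup

end MetricCompact

end

open MetricCompact

namespace MetricCompact

/-! ### The strip through the identity -/

/-! The relator loops based at the powers of `axis` glue into a strip: a middle row with no edges of
its own, joined by `a`-edges to a `b`-line and by `d`-edges to a `c`-line. The whole proof reduces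
to this strip. Summing the strip edges crossed by a path gives a map `coord` on the group that is
injective on the strip and constant along every other edge. Hence each vertex `y` has a gate `p` in
the strip, through which all distances from `y` to the strip pass (`dist_eq_dist_add_dist`).
Distances inside the strip are bounded below by 1-Lipschitz functions of `coord`.

A minimal path from `a` to a middle vertex must raise a height function at each step, which leaves
no choice (`isOnlyMinimalPath_of_height`).

For the boundary, take a limit point `midLimit` of the middle vertices. It weighs the two sides
equally, so a ray converging to it must eventually have its gate on the middle row, arbitrarily far
along (`eq_midVertex_of_dist_eq`). But stopping at a middle vertex on the way to a later one costs
two extra steps (`dist_midVertex_lt`), while distances along an almost-geodesic ray in a graph are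
eventually exactly additive. -/

/-- The element `a b a⁻¹ = d c⁻¹ d⁻¹`, which translates the strip through the identity. -/
def axis : ABCD := gA * gB * gA⁻¹

theorem axis_eq : axis = gD * gC⁻¹ * gD⁻¹ := by
  have h : gA * gB * gA⁻¹ * gD * gC * gD⁻¹ = 1 :=
    PresentedGroup.one_of_mem (rels := {relator}) (x := relator) rfl
  rw [axis, ← mul_inv_eq_one]
  simpa [mul_assoc] using h

/-- The vertices on the middle line of the strip. -/
def midVertex (k : ℤ) : ABCD := axis ^ k

/-- The vertices on the `b`-line of the strip. -/
def leftVertex (k : ℤ) : ABCD := axis ^ k * gA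

/-- The vertices on the `c`-line of the strip. -/
def rightVertex (k : ℤ) : ABCD := axis ^ k * gD

theorem leftVertex_mul_gB (k : ℤ) : leftVertex k * gB = leftVertex (k + 1) := by
  simp [leftVertex, zpow_add, axis, mul_assoc]

theorem rightVertex_mul_gC (k : ℤ) : rightVertex (k + 1) * gC = rightVertex k := by
  simp [rightVertex, zpow_add, axis_eq, mul_assoc]

/-- `v` and `w` are joined by an edge of the strip (in one of its two directions). -/
def StripEdge (v w : ABCD) : Prop :=
  ∃ k : ℤ, (v = midVertex k ∧ w = leftVertex k) ∨ (v = midVertex k ∧ w = rightVertex k) ∨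
    (v = leftVertex k ∧ w = leftVertex (k + 1)) ∨ (v = rightVertex (k + 1) ∧ w = rightVertex k)

/-! ### Coordinates along the strip -/

/-- The action of a group `G` on functions on `G` by right translation of the argument. -/
def rightTranslation (G A : Type*) [Group G] [CommGroup A] : G →* MulAut (G → A) where
  toFun g :=
    { toFun := fun f x => f (x * g)
      invFun := fun f x => f (x * g⁻¹)
      left_inv := fun f => by ext x; simp
      right_inv := fun f => by ext x; simp
      map_mul' := fun _ _ => rfl }
  map_one' := by ext f x; simp
  map_mul' g h := by ext f x; simp [mul_assoc]

theorem rightTranslation_apply {G A : Type*} [Group G] [CommGroup A] (g : G) (f : G → A) (x : G) :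
    rightTranslation G A g f x = f (x * g) := rfl

/-- Coordinates for the vertices of the strip: left line, height, right line. -/
abbrev Coord : Type := ℤ × ℤ × ℤ

open Classical in
/-- The change of coordinates along an edge labelled by a generator; it vanishes unless the edge
lies in the strip. -/
noncomputable def coordStep (i : Fin 4) (g : ABCD) : Coord :=
  match i with
  | 0 => if g ∈ Subgroup.zpowers axis then (1, 0, 0) else 0
  | 1 => if g * (gen 0)⁻¹ ∈ Subgroup.zpowers axis then (0, 1, 0) else 0
  | 2 => if g * (gen 3)⁻¹ ∈ Subgroup.zpowers axis then (0, -1, 0) else 0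
  | 3 => if g ∈ Subgroup.zpowers axis then (0, 0, 1) else 0

/-- The semidirect product in which the coordinates are integrated along paths. -/
abbrev CoordProduct : Type :=
  (ABCD → Multiplicative Coord) ⋊[rightTranslation ABCD (Multiplicative Coord)] ABCD

/-- The cocycle rule: when a product is read from the base point `x`, its second factor is read from
where the first one ends. Thus left components are sums of steps along paths. -/
theorem CoordProduct.mul_left_apply (p q : CoordProduct) (x : ABCD) :
    (p * q).left x = p.left x * q.left (x * p.right) := rfl

theorem CoordProduct.inv_left_apply (p : CoordProduct) (x : ABCD) :
    (p⁻¹).left x = (p.left (x * p.right⁻¹))⁻¹ := rfl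

/-- All six membership conditions along the loop based at `x` reduce to `x ∈ ⟨axis⟩`. So either no
edge of the loop counts, or all do and the steps cancel in pairs. -/
theorem lift_coordStep_relator :
    FreeGroup.lift (fun i => (⟨fun g => .ofAdd (coordStep i g), gen i⟩ : CoordProduct)) relator
      = 1 := by
  have hrel : gen 0 * gen 1 * (gen 0)⁻¹ * gen 3 * gen 2 * (gen 3)⁻¹ = 1 :=
    PresentedGroup.one_of_mem (rels := {relator}) (x := relator) rfl
  have hax : gen 0 * gen 1 * (gen 0)⁻¹ = axis := rfl
  have hax' : axis * gen 3 * gen 2 * (gen 3)⁻¹ = 1 := hrel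
  have hmem (x : ABCD) : x * axis ∈ Subgroup.zpowers axis ↔ x ∈ Subgroup.zpowers axis :=
    Subgroup.mul_mem_cancel_right _ (Subgroup.mem_zpowers axis)
  apply SemidirectProduct.ext
  · funext x
    apply Multiplicative.toAdd.injective
    simp only [relator, map_mul, map_inv, FreeGroup.lift_apply_of]
    simp only [CoordProduct.mul_left_apply, CoordProduct.inv_left_apply,
      SemidirectProduct.mul_right, SemidirectProduct.inv_right, toAdd_mul, toAdd_inv, toAdd_ofAdd,
      SemidirectProduct.one_left, Pi.one_apply, toAdd_one, hax]
    have h1 : x * (axis * gen 3) * (gen 3)⁻¹ = x * axis := by simp [mul_assoc]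
    have h2 : x * (gen 0 * gen 1) * (gen 0)⁻¹ = x * axis := by simp [← hax, mul_assoc]
    have h3 : x * (axis * gen 3 * gen 2) * (gen 3)⁻¹ = x := by rw [mul_assoc, hax', mul_one]
    simp only [coordStep, mul_inv_cancel_right, h1, h2, h3, hmem]
    split_ifs <;> simp
  · simpa [relator, mul_assoc] using hrel

/-- Integration of `coordStep` along paths from the identity. -/
noncomputable def coordHom : ABCD →* CoordProduct :=
  PresentedGroup.toGroup (rels := {relator})
    (f := fun i => (⟨fun g => .ofAdd (coordStep i g), gen i⟩ : CoordProduct))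
    (by rintro r rfl; exact lift_coordStep_relator)

theorem coordHom_gen (i : Fin 4) :
    coordHom (gen i) = ⟨fun g => .ofAdd (coordStep i g), gen i⟩ :=
  PresentedGroup.toGroup.of _

theorem coordHom_right (g : ABCD) : (coordHom g).right = g := by
  have h : SemidirectProduct.rightHom.comp coordHom = MonoidHom.id ABCD :=
    PresentedGroup.ext (rels := {relator}) fun i => by
      change (coordHom (gen i)).right = gen i
      rw [coordHom_gen]
  exact DFunLike.congr_fun h g

/-- The coordinates of the vertex of the strip that is closest to `g`. -/
noncomputable def coord (g : ABCD) : Coord := (((coordHom g).left) 1).toAdd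

theorem coord_one : coord 1 = 0 := by simp [coord]

theorem coord_mul_gen (g : ABCD) (i : Fin 4) : coord (g * gen i) = coord g + coordStep i g := by
  simp [coord, map_mul, coordHom_gen, coordHom_right, rightTranslation_apply]

theorem coord_mul_gA {g : ABCD} (hg : g ∈ Subgroup.zpowers axis) :
    coord (g * gA) = coord g + (1, 0, 0) := by
  simp [gA, coord_mul_gen, coordStep, hg]

theorem coord_mul_gD {g : ABCD} (hg : g ∈ Subgroup.zpowers axis) :
    coord (g * gD) = coord g + (0, 0, 1) := by
  simp [gD, coord_mul_gen, coordStep, hg]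

theorem coord_mul_axis {g : ABCD} (hg : g ∈ Subgroup.zpowers axis) :
    coord (g * axis) = coord g + (0, 1, 0) := by
  have h2 := coord_mul_gA (mul_mem hg (Subgroup.mem_zpowers axis))
  have h3 : coord (g * gA * gB) = coord (g * gA) + (0, 1, 0) := by
    simp only [gB, gA, coord_mul_gen (g * gen 0), coordStep, mul_inv_cancel_right, hg, if_true]
  rw [show g * gA * gB = g * axis * gA by simp [axis, mul_assoc], h2, coord_mul_gA hg] at h3
  rw [add_right_comm] at h3
  exact add_right_cancel h3

theorem coord_midVertex (k : ℤ) : coord (midVertex k) = (0, k, 0) := by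
  have hmem (k : ℤ) : axis ^ k ∈ Subgroup.zpowers axis := Subgroup.zpow_mem_zpowers _ _
  unfold midVertex
  induction k using Int.induction_on with
  | zero => rw [zpow_zero]; exact coord_one
  | succ k ih => rw [zpow_add_one, coord_mul_axis (hmem _), ih]; simp
  | pred k ih =>
    have h := coord_mul_axis (hmem (-k - 1))
    rw [← zpow_add_one, sub_add_cancel, ih] at h
    rw [eq_sub_of_add_eq h.symm]; simp

theorem coord_leftVertex (k : ℤ) : coord (leftVertex k) = (1, k, 0) := by
  rw [leftVertex, coord_mul_gA (Subgroup.zpow_mem_zpowers _ _), ← midVertex, coord_midVertex]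
  simp

theorem coord_rightVertex (k : ℤ) : coord (rightVertex k) = (0, k, 1) := by
  rw [rightVertex, coord_mul_gD (Subgroup.zpow_mem_zpowers _ _), ← midVertex,
    coord_midVertex]
  simp

theorem coord_mul_gen_or_stripEdge (g : ABCD) (i : Fin 4) :
    coord g = coord (g * gen i) ∨ StripEdge g (g * gen i) := by
  by_cases h : coordStep i g = 0
  · left; rw [coord_mul_gen, h, add_zero]
  right
  fin_cases i <;> simp only [coordStep, ite_eq_right_iff, Classical.not_imp] at h <;> obtain ⟨⟨k, hk⟩, -⟩ := h <;>
    simp only at hk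
  · exact ⟨k, .inl ⟨hk.symm, by rw [leftVertex, hk]; rfl⟩⟩
  · have hg : g = leftVertex k := by rw [leftVertex, hk, gA, inv_mul_cancel_right]
    exact ⟨k, .inr (.inr (.inl ⟨hg, by rw [hg]; exact leftVertex_mul_gB k⟩))⟩
  · have hg : g = rightVertex (k - 1 + 1) := by
      rw [sub_add_cancel, rightVertex, hk, gD, inv_mul_cancel_right]
    exact ⟨k - 1, .inr (.inr (.inr ⟨hg, by rw [hg]; exact rightVertex_mul_gC _⟩))⟩
  · exact ⟨k, .inr (.inl ⟨hk.symm, by rw [rightVertex, hk]; rfl⟩)⟩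

theorem exists_gen_of_adj {v w : ABCD} (h : cayleyGraph.Adj v w) :
    ∃ i, w = v * gen i ∨ v = w * gen i := by
  obtain ⟨-, s, hs, h⟩ := (SimpleGraph.mulCayley_adj' _ v w).1 h
  obtain ⟨i, rfl⟩ : ∃ i, s = gen i := by
    rcases hs with rfl | rfl | rfl | rfl
    exacts [⟨0, rfl⟩, ⟨1, rfl⟩, ⟨2, rfl⟩, ⟨3, rfl⟩]
  exact ⟨i, h.imp Eq.symm id⟩

theorem coord_eq_or_stripEdge_of_adj {v w : ABCD} (h : cayleyGraph.Adj v w) :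
    coord v = coord w ∨ StripEdge v w ∨ StripEdge w v := by
  obtain ⟨i, rfl | rfl⟩ := exists_gen_of_adj h
  · exact (coord_mul_gen_or_stripEdge v i).imp_right .inl
  · exact (coord_mul_gen_or_stripEdge w i).imp Eq.symm .inr

/-- Needed because the Cayley graph has no loops. Without their membership conditions, the
coordinate steps define a homomorphism to `ℤ³` that kills no generator. -/
theorem gen_ne_one (i : Fin 4) : gen i ≠ 1 := by
  intro h
  let f : Fin 4 → Multiplicative Coord :=
    ![.ofAdd (1, 0, 0), .ofAdd (0, 1, 0), .ofAdd (0, -1, 0), .ofAdd (0, 0, 1)]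
  have hf : ∀ r ∈ ({relator} : Set (FreeGroup (Fin 4))), FreeGroup.lift f r = 1 := by
    rintro r rfl
    simp only [relator, map_mul, map_inv, FreeGroup.lift_apply_of]
    decide
  have h1 : f i = 1 := by
    rw [← PresentedGroup.toGroup.of hf, show PresentedGroup.of i = (1 : ABCD) from h]
    exact map_one _
  revert h1
  fin_cases i <;> decide

theorem adj_mul_gen (v : ABCD) (i : Fin 4) : cayleyGraph.Adj v (v * gen i) := by
  refine (SimpleGraph.mulCayley_adj' _ _ _).2 ⟨?_, gen i, ?_, .inl rfl⟩
  · simpa [eq_comm] using gen_ne_one i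
  · fin_cases i <;> simp [gA, gB, gC, gD]

theorem StripEdge.adj {v w : ABCD} (h : StripEdge v w) : cayleyGraph.Adj v w := by
  obtain ⟨k, ⟨rfl, rfl⟩ | ⟨rfl, rfl⟩ | ⟨rfl, rfl⟩ | ⟨rfl, rfl⟩⟩ := h
  · exact adj_mul_gen _ 0
  · exact adj_mul_gen _ 3
  · rw [← leftVertex_mul_gB]; exact adj_mul_gen _ 1
  · rw [← rightVertex_mul_gC k]; exact adj_mul_gen _ 2

/-! ### Distances to the strip -/

/-- The vertices of the strip through the identity. -/
def strip : Set ABCD := {v | ∃ k, v = midVertex k ∨ v = leftVertex k ∨ v = rightVertex k}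

theorem midVertex_mem_strip (k : ℤ) : midVertex k ∈ strip := ⟨k, .inl rfl⟩

theorem leftVertex_mem_strip (k : ℤ) : leftVertex k ∈ strip := ⟨k, .inr (.inl rfl)⟩

theorem rightVertex_mem_strip (k : ℤ) : rightVertex k ∈ strip := ⟨k, .inr (.inr rfl)⟩

theorem StripEdge.mem_strip {v w : ABCD} (h : StripEdge v w) : v ∈ strip ∧ w ∈ strip := by
  obtain ⟨k, ⟨rfl, rfl⟩ | ⟨rfl, rfl⟩ | ⟨rfl, rfl⟩ | ⟨rfl, rfl⟩⟩ := h
  · exact ⟨midVertex_mem_strip k, leftVertex_mem_strip k⟩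
  · exact ⟨midVertex_mem_strip k, rightVertex_mem_strip k⟩
  · exact ⟨leftVertex_mem_strip _, leftVertex_mem_strip _⟩
  · exact ⟨rightVertex_mem_strip _, rightVertex_mem_strip _⟩

theorem coord_injOn_strip : Set.InjOn coord strip := by
  rintro v ⟨j, rfl | rfl | rfl⟩ w ⟨k, rfl | rfl | rfl⟩ h <;>
    simp [coord_midVertex, coord_leftVertex, coord_rightVertex] at h <;> rw [h]

/-- Along a walk to the strip, `coord` stays constant until the first strip edge, whose starting
point serves as `p`; if there is none, the endpoint does. -/
theorem exists_mem_strip_coord_eq (v : ABCD) : ∃ p ∈ strip, coord p = coord v := by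
  have h0 := midVertex_mem_strip 0
  generalize midVertex 0 = x at h0
  obtain ⟨q⟩ := cayleyGraph_connected.preconnected v x
  induction q with
  | nil => exact ⟨_, h0, rfl⟩
  | cons h q ih =>
    rcases coord_eq_or_stripEdge_of_adj h with h | h | h
    · rw [h]; exact ih h0
    · exact ⟨_, h.mem_strip.1, rfl⟩
    · exact ⟨_, h.mem_strip.2, rfl⟩

/-- Before its first strip edge the walk keeps the coordinates of `y`. When it reaches that edge, or
its end, it is at a strip vertex with the coordinates of `p`, hence at `p` itself by injectivity. -/
theorem dist_add_dist_le_length {x y p : ABCD} (hx : x ∈ strip) (hp : p ∈ strip)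
    (h : coord p = coord y) (q : cayleyGraph.Walk y x) :
    cayleyGraph.dist y p + cayleyGraph.dist p x ≤ q.length := by
  have key {y x : ABCD} (q : cayleyGraph.Walk y x) (hy : y ∈ strip) (h : coord p = coord y) :
      cayleyGraph.dist y p + cayleyGraph.dist p x ≤ q.length := by
    obtain rfl := coord_injOn_strip hp hy h
    simpa using SimpleGraph.dist_le q
  induction q with
  | nil => exact key _ hx h
  | @cons u v w hadj q ih =>
    rcases coord_eq_or_stripEdge_of_adj hadj with huv | huv | huv
    · have h1 := ih hx (h.trans huv)
      have h2 := cayleyGraph_connected.dist_triangle (u := u) (v := v) (w := p)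
      rw [SimpleGraph.dist_eq_one_iff_adj.2 hadj] at h2
      rw [SimpleGraph.Walk.length_cons]
      lia
    · exact key _ huv.mem_strip.1 h
    · exact key _ huv.mem_strip.2 h

theorem dist_eq_dist_add_dist {x y p : ABCD} (hx : x ∈ strip) (hp : p ∈ strip)
    (h : coord p = coord y) :
    cayleyGraph.dist y x = cayleyGraph.dist y p + cayleyGraph.dist p x := by
  obtain ⟨q, hq⟩ := cayleyGraph_connected.exists_walk_length_eq_dist y x
  exact le_antisymm cayleyGraph_connected.dist_triangle (hq ▸ dist_add_dist_le_length hx hp h q)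

/-- Functions of the coordinates that change by at most one along the edges of the strip. -/
structure IsStripLipschitz (f : Coord → ℤ) : Prop where
  left (k : ℤ) : |f (0, k, 0) - f (1, k, 0)| ≤ 1
  right (k : ℤ) : |f (0, k, 0) - f (0, k, 1)| ≤ 1
  left_succ (k : ℤ) : |f (1, k, 0) - f (1, k + 1, 0)| ≤ 1
  right_succ (k : ℤ) : |f (0, k + 1, 1) - f (0, k, 1)| ≤ 1

namespace IsStripLipschitz

variable {f : Coord → ℤ}

theorem abs_sub_le_one (hf : IsStripLipschitz f) {v w : ABCD} (h : cayleyGraph.Adj v w) :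
    |f (coord v) - f (coord w)| ≤ 1 := by
  have key {v w : ABCD} (h : StripEdge v w) : |f (coord v) - f (coord w)| ≤ 1 := by
    obtain ⟨k, ⟨rfl, rfl⟩ | ⟨rfl, rfl⟩ | ⟨rfl, rfl⟩ | ⟨rfl, rfl⟩⟩ := h <;>
      simp only [coord_midVertex, coord_leftVertex, coord_rightVertex]
    exacts [hf.left k, hf.right k, hf.left_succ k, hf.right_succ k]
  rcases coord_eq_or_stripEdge_of_adj h with h | h | h
  · simp [h]
  · exact key h
  · rw [abs_sub_comm]; exact key h

theorem sub_le_length (hf : IsStripLipschitz f) {v w : ABCD} (q : cayleyGraph.Walk v w) :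
    f (coord v) - f (coord w) ≤ q.length := by
  induction q with
  | nil => simp
  | cons h q ih =>
    have := (abs_le.1 (hf.abs_sub_le_one h)).2
    rw [SimpleGraph.Walk.length_cons]
    push_cast
    lia

theorem sub_le_dist (hf : IsStripLipschitz f) (v w : ABCD) :
    f (coord v) - f (coord w) ≤ cayleyGraph.dist v w := by
  obtain ⟨q, hq⟩ := cayleyGraph_connected.exists_walk_length_eq_dist v w
  exact hq ▸ hf.sub_le_length q

end IsStripLipschitz

/-- This function and the next two are the distances within the strip to the left, right and middle
vertex at height `k`. They vanish there, so `sub_le_dist` turns them into lower bounds. -/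
theorem isStripLipschitz_left (k : ℤ) :
    IsStripLipschitz fun x => |x.2.1 - k| + 1 - x.1 + x.2.2 := by
  constructor <;> intro j <;> simp only <;> grind

theorem isStripLipschitz_right (k : ℤ) :
    IsStripLipschitz fun x => |x.2.1 - k| + 1 + x.1 - x.2.2 := by
  constructor <;> intro j <;> simp only <;> grind

theorem isStripLipschitz_mid (k : ℤ) :
    IsStripLipschitz fun x => |x.2.1 - k| + if x.1 = 0 ∧ x.2.2 = 0 then
      (if x.2.1 = k then 0 else 2) else 1 := by
  constructor <;> intro j <;> simp only <;> grind

/-! ### Distances between vertices of the strip -/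

theorem dist_midVertex_leftVertex_self (k : ℤ) :
    cayleyGraph.dist (midVertex k) (leftVertex k) = 1 :=
  SimpleGraph.dist_eq_one_iff_adj.2 (StripEdge.adj ⟨k, .inl ⟨rfl, rfl⟩⟩)

theorem dist_midVertex_rightVertex_self (k : ℤ) :
    cayleyGraph.dist (midVertex k) (rightVertex k) = 1 :=
  SimpleGraph.dist_eq_one_iff_adj.2 (StripEdge.adj ⟨k, .inr (.inl ⟨rfl, rfl⟩)⟩)

theorem dist_le_abs_sub_of_adj_succ {V : Type*} {Γ : SimpleGraph V} (hΓ : Γ.Connected) {u : ℤ → V}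
    (hu : ∀ k, Γ.Adj (u k) (u (k + 1))) (j k : ℤ) : (Γ.dist (u j) (u k) : ℤ) ≤ |j - k| := by
  have key (j : ℤ) (n : ℕ) : Γ.dist (u j) (u (j + n)) ≤ n := by
    induction n with
    | zero => simp
    | succ n ih =>
      have h := hΓ.dist_triangle (u := u j) (v := u (j + n)) (w := u (j + n + 1))
      rw [SimpleGraph.dist_eq_one_iff_adj.2 (hu _)] at h
      push_cast
      rw [← add_assoc]
      lia
  rcases le_total j k with h | h
  · have := key j (k - j).toNat
    rw [Int.toNat_of_nonneg (by lia), add_sub_cancel] at this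
    grind
  · have := key k (j - k).toNat
    rw [Int.toNat_of_nonneg (by lia), add_sub_cancel, SimpleGraph.dist_comm] at this
    grind

theorem dist_leftVertex_le (j k : ℤ) :
    (cayleyGraph.dist (leftVertex j) (leftVertex k) : ℤ) ≤ |j - k| :=
  dist_le_abs_sub_of_adj_succ cayleyGraph_connected
    (fun k => StripEdge.adj ⟨k, .inr (.inr (.inl ⟨rfl, rfl⟩))⟩) j k

theorem dist_rightVertex_le (j k : ℤ) :
    (cayleyGraph.dist (rightVertex j) (rightVertex k) : ℤ) ≤ |j - k| :=
  dist_le_abs_sub_of_adj_succ cayleyGraph_connected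
    (fun k => (StripEdge.adj ⟨k, .inr (.inr (.inr ⟨rfl, rfl⟩))⟩).symm) j k

theorem dist_midVertex_leftVertex (j k : ℤ) :
    (cayleyGraph.dist (midVertex j) (leftVertex k) : ℤ) = |j - k| + 1 := by
  apply le_antisymm
  · have h1 := cayleyGraph_connected.dist_triangle (u := midVertex j) (v := leftVertex j)
      (w := leftVertex k)
    have h2 := dist_leftVertex_le j k
    rw [dist_midVertex_leftVertex_self] at h1
    lia
  · simpa [coord_midVertex, coord_leftVertex] using
      (isStripLipschitz_left k).sub_le_dist (midVertex j) (leftVertex k)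

theorem dist_midVertex_rightVertex (j k : ℤ) :
    (cayleyGraph.dist (midVertex j) (rightVertex k) : ℤ) = |j - k| + 1 := by
  apply le_antisymm
  · have h1 := cayleyGraph_connected.dist_triangle (u := midVertex j) (v := rightVertex j)
      (w := rightVertex k)
    have h2 := dist_rightVertex_le j k
    rw [dist_midVertex_rightVertex_self] at h1
    lia
  · simpa [coord_midVertex, coord_rightVertex] using
      (isStripLipschitz_right k).sub_le_dist (midVertex j) (rightVertex k)

theorem dist_midVertex_midVertex {j k : ℤ} (h : j ≠ k) :
    (cayleyGraph.dist (midVertex j) (midVertex k) : ℤ) = |j - k| + 2 := by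
  apply le_antisymm
  · have h1 := cayleyGraph_connected.dist_triangle (u := midVertex j) (v := leftVertex k)
      (w := midVertex k)
    have h2 := dist_midVertex_leftVertex j k
    rw [SimpleGraph.dist_comm (u := leftVertex k), dist_midVertex_leftVertex_self] at h1
    lia
  · simpa [coord_midVertex, h] using
      (isStripLipschitz_mid k).sub_le_dist (midVertex j) (midVertex k)

theorem dist_leftVertex_rightVertex_ge (j k : ℤ) :
    |j - k| + 2 ≤ (cayleyGraph.dist (leftVertex j) (rightVertex k) : ℤ) := by
  have := (isStripLipschitz_right k).sub_le_dist (leftVertex j) (rightVertex k)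
  simp [coord_leftVertex, coord_rightVertex] at this
  lia

theorem dist_leftVertex_rightVertex_self (k : ℤ) :
    cayleyGraph.dist (leftVertex k) (rightVertex k) = 2 := by
  have h1 := dist_leftVertex_rightVertex_ge k k
  have h2 := cayleyGraph_connected.dist_triangle (u := leftVertex k) (v := midVertex k)
    (w := rightVertex k)
  rw [SimpleGraph.dist_comm (v := midVertex k), dist_midVertex_leftVertex_self,
    dist_midVertex_rightVertex_self] at h2
  simp at h1
  lia

/-! ### Unique minimal paths -/

/-- A criterion for `bⁿ e` to be the only minimal path from `g` to `g bⁿ e`: it follows a function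
`F` that grows by at most one along each edge, and there is no other way to make `F` grow. -/
theorem isOnlyMinimalPath_of_height {G : Type*} [Group G] {Γ : SimpleGraph G} (hΓ : Γ.Connected)
    (g b e : G) (n : ℕ) (F : G → ℤ) (hF : ∀ {v w}, Γ.Adj v w → F w ≤ F v + 1)
    (hb : ∀ k : ℕ, F (g * b ^ k) = k) (he : ∀ k : ℕ, F (g * b ^ k * e) = k + 1)
    (hbF : ∀ (k : ℕ) (w : G), Γ.Adj (g * b ^ k) w → F w = k + 1 →
      w = g * b ^ (k + 1) ∨ w = g * b ^ k * e)
    (heF : ∀ (k : ℕ) (w : G), Γ.Adj (g * b ^ k * e) w → F w ≠ k + 2)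
    (hd : Γ.dist g (g * b ^ n * e) = n + 1) :
    IsOnlyMinimalPath Γ g (g * b ^ n * e) (List.replicate n b ++ [e]) := by
  have hlen {v w : G} (q : Γ.Walk v w) : F w ≤ F v + q.length := by
    induction q with
    | nil => simp
    | cons h q ih =>
      have := hF h
      rw [SimpleGraph.Walk.length_cons]
      push_cast
      lia
  have key (m : ℕ) : ∀ k, k + m = n → ∀ u, u = g * b ^ k → ∀ y, y = g * b ^ n * e → ∀ q : Γ.Walk u y,
      q.length = m + 1 → q.support = pathVertices u (List.replicate m b ++ [e]) := by
    induction m with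
    | zero =>
      rintro k rfl u hu y hy q hq
      match q with
      | .cons h .nil => simp [pathVertices, hu, hy]
    | succ m ih =>
      rintro k rfl u hu y hy q hq
      cases q with
      | nil => simp at hq
      | @cons _ w _ h q =>
        rw [SimpleGraph.Walk.length_cons, Nat.add_right_cancel_iff] at hq
        have h1 := hlen q
        have h2 := hF h
        rw [hq, hy, he] at h1
        rw [hu, hb] at h2
        push_cast at h1
        -- The remaining `m + 1` edges raise `F` by at most `m + 1`, so this edge must raise it by
        -- exactly one.
        rcases hbF k w (hu ▸ h) (by lia) with hw | hw
        · rw [SimpleGraph.Walk.support_cons, ih (k + 1) (by lia) w hw y hy q hq, hw, hu]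
          simp [pathVertices, List.replicate_succ, pow_succ, mul_assoc]
        · cases q with
          | nil => simp at hq
          | cons h' q =>
            subst hw
            rw [SimpleGraph.Walk.length_cons, Nat.add_right_cancel_iff] at hq
            have h3 := hlen q
            have h4 := hF h'
            rw [hq, hy, he] at h3
            rw [he] at h4
            push_cast at h3
            -- Taking `e` too early is fatal: the next edge would again have to raise `F`, which
            -- `heF` forbids.
            exact absurd (by lia) (heF k _ h')
  have key' (q : Γ.Walk g (g * b ^ n * e)) (hq : IsMinimalPath q) :
      q.support = pathVertices g (List.replicate n b ++ [e]) :=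
    key n 0 (zero_add n) g (by simp) _ rfl q (hq.trans hd)
  obtain ⟨p, hp⟩ := hΓ.exists_walk_length_eq_dist g (g * b ^ n * e)
  exact ⟨p, hp, key' p hp, fun q hq => SimpleGraph.Walk.ext_support ((key' q hq).trans
    (key' p hp).symm)⟩

/-! ### Minimal paths along the two sides of the strip -/

theorem isStripLipschitz_left_height : IsStripLipschitz fun x => x.2.1 + 1 - x.1 := by
  constructor <;> intro j <;> simp only <;> grind

theorem isStripLipschitz_right_height : IsStripLipschitz fun x => x.2.1 + 1 - x.2.2 := by
  constructor <;> intro j <;> simp only <;> grind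

theorem gA_mul_gB_pow (k : ℕ) : gA * gB ^ k = leftVertex k := by
  induction k with
  | zero => simp [leftVertex]
  | succ k ih => rw [pow_succ, ← mul_assoc, ih, leftVertex_mul_gB]; simp

theorem gD_mul_gC_inv_pow (k : ℕ) : gD * gC⁻¹ ^ k = rightVertex k := by
  induction k with
  | zero => simp [rightVertex]
  | succ k ih =>
    rw [pow_succ, ← mul_assoc, ih, ← rightVertex_mul_gC, mul_inv_cancel_right]; simp

theorem leftVertex_mul_gA_inv (k : ℤ) : leftVertex k * gA⁻¹ = midVertex k := by
  simp [leftVertex, midVertex]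

theorem rightVertex_mul_gD_inv (k : ℤ) : rightVertex k * gD⁻¹ = midVertex k := by
  simp [rightVertex, midVertex]

theorem gA_mul_gB_pow_mul_gA_inv (n : ℕ) : gA * gB ^ n * gA⁻¹ = midVertex n := by
  rw [gA_mul_gB_pow, leftVertex_mul_gA_inv]

theorem gD_mul_gC_inv_pow_mul_gD_inv (n : ℕ) : gD * gC⁻¹ ^ n * gD⁻¹ = midVertex n := by
  rw [gD_mul_gC_inv_pow, rightVertex_mul_gD_inv]

theorem leftVertex_zero : leftVertex 0 = gA := by simp [leftVertex]

theorem rightVertex_zero : rightVertex 0 = gD := by simp [rightVertex]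

theorem dist_gA_midVertex (n : ℕ) : cayleyGraph.dist gA (midVertex n) = n + 1 := by
  have := dist_midVertex_leftVertex n 0
  rw [leftVertex_zero, sub_zero, Nat.abs_cast] at this
  rw [SimpleGraph.dist_comm]
  exact_mod_cast this

theorem dist_gD_midVertex (n : ℕ) : cayleyGraph.dist gD (midVertex n) = n + 1 := by
  have := dist_midVertex_rightVertex n 0
  rw [rightVertex_zero, sub_zero, Nat.abs_cast] at this
  rw [SimpleGraph.dist_comm]
  exact_mod_cast this

/-- The height is `k` on the left line and `k + 1` on the other two, at level `k`. From a left
vertex only `b` and `a⁻¹` raise it; from a middle vertex nothing does. Edges outside the strip leave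
it unchanged. -/
theorem isOnlyMinimalPath_gA (n : ℕ) :
    IsOnlyMinimalPath cayleyGraph gA (gA * gB ^ n * gA⁻¹) (List.replicate n gB ++ [gA⁻¹]) := by
  refine isOnlyMinimalPath_of_height cayleyGraph_connected gA gB gA⁻¹ n
    (fun v => (coord v).2.1 + 1 - (coord v).1) ?_ ?_ ?_ ?_ ?_ ?_
  · intro v w h
    have := (abs_le.1 (isStripLipschitz_left_height.abs_sub_le_one h)).1
    lia
  · intro k; simp [gA_mul_gB_pow, coord_leftVertex]
  · intro k; simp [gA_mul_gB_pow_mul_gA_inv, coord_midVertex]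
  · intro k w h hw
    rw [gA_mul_gB_pow_mul_gA_inv, gA_mul_gB_pow, Nat.cast_succ]
    rw [gA_mul_gB_pow] at h
    rcases coord_eq_or_stripEdge_of_adj h with h | h | h
    · rw [← h, coord_leftVertex] at hw
      simp at hw
    · obtain ⟨j, ⟨hj, rfl⟩ | ⟨hj, rfl⟩ | ⟨hj, rfl⟩ | ⟨hj, rfl⟩⟩ := h <;>
        replace hj := congr_arg coord hj <;>
        simp [coord_leftVertex, coord_midVertex, coord_rightVertex] at hj hw
      exact .inl (by rw [hj])
    · obtain ⟨j, ⟨rfl, hj⟩ | ⟨rfl, hj⟩ | ⟨rfl, hj⟩ | ⟨rfl, hj⟩⟩ := h <;>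
        replace hj := congr_arg coord hj <;>
        simp [coord_leftVertex, coord_midVertex, coord_rightVertex] at hj hw
      · exact .inr (by rw [hj])
      · lia
  · intro k w h hw
    rw [gA_mul_gB_pow_mul_gA_inv] at h
    rcases coord_eq_or_stripEdge_of_adj h with h | h | h
    · rw [← h, coord_midVertex] at hw
      simp at hw
    · obtain ⟨j, ⟨hj, rfl⟩ | ⟨hj, rfl⟩ | ⟨hj, rfl⟩ | ⟨hj, rfl⟩⟩ := h <;>
        replace hj := congr_arg coord hj <;>
        simp [coord_leftVertex, coord_midVertex, coord_rightVertex] at hj hw <;> lia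
    · obtain ⟨j, ⟨rfl, hj⟩ | ⟨rfl, hj⟩ | ⟨rfl, hj⟩ | ⟨rfl, hj⟩⟩ := h <;>
        replace hj := congr_arg coord hj <;>
        simp [coord_leftVertex, coord_midVertex, coord_rightVertex] at hj
  · rw [gA_mul_gB_pow_mul_gA_inv, dist_gA_midVertex]

theorem isOnlyMinimalPath_gD (n : ℕ) :
    IsOnlyMinimalPath cayleyGraph gD (gD * gC⁻¹ ^ n * gD⁻¹)
      (List.replicate n gC⁻¹ ++ [gD⁻¹]) := by
  refine isOnlyMinimalPath_of_height cayleyGraph_connected gD gC⁻¹ gD⁻¹ n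
    (fun v => (coord v).2.1 + 1 - (coord v).2.2) ?_ ?_ ?_ ?_ ?_ ?_
  · intro v w h
    have := (abs_le.1 (isStripLipschitz_right_height.abs_sub_le_one h)).1
    lia
  · intro k; simp [-inv_pow, gD_mul_gC_inv_pow, coord_rightVertex]
  · intro k; simp [-inv_pow, gD_mul_gC_inv_pow_mul_gD_inv, coord_midVertex]
  · intro k w h hw
    rw [gD_mul_gC_inv_pow_mul_gD_inv, gD_mul_gC_inv_pow, Nat.cast_succ]
    rw [gD_mul_gC_inv_pow] at h
    rcases coord_eq_or_stripEdge_of_adj h with h | h | h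
    · rw [← h, coord_rightVertex] at hw
      simp at hw
    · obtain ⟨j, ⟨hj, rfl⟩ | ⟨hj, rfl⟩ | ⟨hj, rfl⟩ | ⟨hj, rfl⟩⟩ := h <;>
        replace hj := congr_arg coord hj <;>
        simp [coord_leftVertex, coord_midVertex, coord_rightVertex] at hj hw
      lia
    · obtain ⟨j, ⟨rfl, hj⟩ | ⟨rfl, hj⟩ | ⟨rfl, hj⟩ | ⟨rfl, hj⟩⟩ := h <;>
        replace hj := congr_arg coord hj <;>
        simp [coord_leftVertex, coord_midVertex, coord_rightVertex] at hj hw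
      · exact .inr (by rw [hj])
      · exact .inl (by rw [hj])
  · intro k w h hw
    rw [gD_mul_gC_inv_pow_mul_gD_inv] at h
    rcases coord_eq_or_stripEdge_of_adj h with h | h | h
    · rw [← h, coord_midVertex] at hw
      simp at hw
    · obtain ⟨j, ⟨hj, rfl⟩ | ⟨hj, rfl⟩ | ⟨hj, rfl⟩ | ⟨hj, rfl⟩⟩ := h <;>
        replace hj := congr_arg coord hj <;>
        simp [coord_leftVertex, coord_midVertex, coord_rightVertex] at hj hw <;> lia
    · obtain ⟨j, ⟨rfl, hj⟩ | ⟨rfl, hj⟩ | ⟨rfl, hj⟩ | ⟨rfl, hj⟩⟩ := h <;>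
        replace hj := congr_arg coord hj <;>
        simp [coord_leftVertex, coord_midVertex, coord_rightVertex] at hj
  · rw [gD_mul_gC_inv_pow_mul_gD_inv, dist_gD_midVertex]

theorem perimeter_gA_midVertex_gD (n : ℕ) :
    perimeter cayleyGraph gA (midVertex n) gD = 2 * n + 4 := by
  rw [perimeter, dist_gA_midVertex, SimpleGraph.dist_comm (u := midVertex n), dist_gD_midVertex,
    SimpleGraph.dist_comm, ← leftVertex_zero, ← rightVertex_zero,
    dist_leftVertex_rightVertex_self]
  lia


/-! ### A boundary point that is not a Busemann point -/

theorem phi_mem_metricAlgebra {X : Type*} [MetricSpace X] (y z : X) :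
    phi y z ∈ metricAlgebra X :=
  StarSubalgebra.le_topologicalClosure _
    (StarAlgebra.subset_adjoin ℂ _ (.inr ⟨(y, z), rfl⟩))

/-- The value of a point of the metric compactification at `φ_{y,z}`. -/
noncomputable def evalPhi {X : Type*} [MetricSpace X] (ω : Compactification X) (y z : X) : ℂ :=
  ω ⟨phi y z, phi_mem_metricAlgebra y z⟩

theorem evalPhi_pointEval {X : Type*} [MetricSpace X] (x y z : X) :
    evalPhi (pointEval x) y z = ((dist x y - dist x z : ℝ) : ℂ) := rfl

theorem continuous_evalPhi {X : Type*} [MetricSpace X] (y z : X) :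
    Continuous fun ω : Compactification X => evalPhi ω y z :=
  (WeakDual.eval_continuous (𝕜 := ℂ) _).comp continuous_subtype_val

theorem evalPhi_pointEval_ABCD (x y z : ABCD) :
    evalPhi (pointEval x) y z =
      (((cayleyGraph.dist x y : ℤ) - (cayleyGraph.dist x z : ℤ) : ℤ) : ℂ) := by
  rw [evalPhi_pointEval]
  change (((cayleyGraph.dist x y : ℝ) - (cayleyGraph.dist x z : ℝ) : ℝ) : ℂ) = _
  push_cast
  rfl

/-- The values of `φ_{y,z}` are integers, so they are eventually constant along a convergent
family of points. -/
theorem eventually_evalPhi_eq {ι : Type*} {l : Filter ι} {u : ι → ABCD}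
    {ω : Compactification ABCD} (h : Tendsto (fun i => pointEval (u i)) l (𝓝 ω)) (y z : ABCD) :
    ∀ᶠ i in l, (((cayleyGraph.dist (u i) y : ℤ) - (cayleyGraph.dist (u i) z : ℤ) : ℤ) : ℂ) =
      evalPhi ω y z := by
  rcases l.eq_or_neBot with rfl | _
  · simp
  have h1 := ((continuous_evalPhi y z).tendsto ω).comp h
  simp only [Function.comp_def, evalPhi_pointEval_ABCD] at h1
  obtain ⟨n, hn⟩ : evalPhi ω y z ∈ Set.range ((↑) : ℤ → ℂ) :=
    (Complex.isClosedEmbedding_intCast).isClosed_range.mem_of_tendsto h1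
      (Eventually.of_forall fun i => ⟨_, rfl⟩)
  rw [← hn] at h1 ⊢
  have h2 := (Complex.isClosedEmbedding_intCast).isInducing.tendsto_nhds_iff.2 h1
  rw [nhds_discrete] at h2
  filter_upwards [h2.eventually (eventually_pure.2 rfl : ∀ᶠ x in pure n, x = n)] with i hi
  rw [hi]

theorem evalPhi_add {X : Type*} [MetricSpace X] (ω : Compactification X) (x y z : X) :
    evalPhi ω x y + evalPhi ω y z = evalPhi ω x z := by
  unfold evalPhi
  rw [← map_add]
  congr 1
  ext t
  simp [phi]

/-- A limit point, in the metric compactification, of the vertices on the middle line. -/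
noncomputable def midLimit : Compactification ABCD :=
  ((hyperfilter ℕ).map fun n => pointEval (midVertex n)).lim

theorem tendsto_midLimit :
    Tendsto (fun n : ℕ => pointEval (midVertex n)) (hyperfilter ℕ) (𝓝 midLimit) :=
  -- Compactness of the character space gives a limit along the ultrafilter, so convergence of the
  -- sequence itself is not needed.
  Ultrafilter.le_nhds_lim _

theorem evalPhi_midLimit_leftVertex (j k : ℤ) :
    evalPhi midLimit (leftVertex k) (leftVertex j) = ((j - k : ℤ) : ℂ) := by
  obtain ⟨n, h, hn⟩ := ((eventually_evalPhi_eq tendsto_midLimit (leftVertex k)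
    (leftVertex j)).and (Nat.hyperfilter_le_atTop (eventually_ge_atTop (max k j).toNat))).exists
  rw [← h, dist_midVertex_leftVertex, dist_midVertex_leftVertex]
  congr 1
  grind

theorem evalPhi_midLimit_rightVertex (k : ℤ) :
    evalPhi midLimit (leftVertex k) (rightVertex k) = 0 := by
  obtain ⟨n, h⟩ := (eventually_evalPhi_eq tendsto_midLimit (leftVertex k)
    (rightVertex k)).exists
  rw [← h, dist_midVertex_leftVertex, dist_midVertex_rightVertex]
  simp

/-- At a point `x`, the difference of distances to `leftVertex m` and `leftVertex 0` is at least
minus the distance from `x` to `leftVertex 0`; at `midLimit` it is `-m`. Taking `m` one larger than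
that distance gives a contradiction. -/
theorem midLimit_mem_metricBoundary : midLimit ∈ metricBoundary ABCD := by
  rintro ⟨x, hx⟩
  have h0 := evalPhi_add midLimit (leftVertex ((cayleyGraph.dist x (leftVertex 0) : ℤ) + 1))
    (leftVertex 0) x
  rw [evalPhi_midLimit_leftVertex, ← hx, evalPhi_pointEval_ABCD, evalPhi_pointEval_ABCD,
    SimpleGraph.dist_self] at h0
  norm_cast at h0
  simp at h0
  lia

/-- A vertex on either side line is strictly closer to the base vertex of its own side, so `h0`
forces the middle row; `h` then forces height at least `k`. -/
theorem eq_midVertex_of_dist_eq {p : ABCD} (hp : p ∈ strip) {k : ℤ} (hk : 1 ≤ k)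
    (h0 : cayleyGraph.dist p (leftVertex 0) = cayleyGraph.dist p (rightVertex 0))
    (h : (cayleyGraph.dist p (leftVertex k) : ℤ) = cayleyGraph.dist p (leftVertex 0) - k) :
    ∃ j ≥ k, p = midVertex j := by
  obtain ⟨j, rfl | rfl | rfl⟩ := hp
  · refine ⟨j, ?_, rfl⟩
    rw [dist_midVertex_leftVertex, dist_midVertex_leftVertex] at h
    grind
  · have h1 := dist_leftVertex_le j 0
    have h2 := dist_leftVertex_rightVertex_ge j 0
    lia
  · have h1 := dist_rightVertex_le j 0
    have h2 := dist_leftVertex_rightVertex_ge 0 j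
    rw [SimpleGraph.dist_comm] at h2
    rw [abs_sub_comm] at h1
    lia

/-- In the direction of `midLimit`, paths to far vertices of the middle line run along one of the
two sides of the strip, and it costs two to come back to an intermediate middle vertex. -/
theorem dist_midVertex_lt {y p : ABCD} (hp : p ∈ strip) (h : coord p = coord y) {j n : ℤ}
    (hpj : (coord y).2.1 < j) (hjn : j < n) :
    cayleyGraph.dist y (midVertex n) <
      cayleyGraph.dist y (midVertex j) + cayleyGraph.dist (midVertex j) (midVertex n) := by
  rw [dist_eq_dist_add_dist (midVertex_mem_strip n) hp h,
    dist_eq_dist_add_dist (midVertex_mem_strip j) hp h]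
  have h3 := dist_midVertex_midVertex hjn.ne
  obtain ⟨i, rfl | rfl | rfl⟩ := hp
  · simp only [← h, coord_midVertex] at hpj
    have h1 := dist_midVertex_midVertex hpj.ne
    have h2 := dist_midVertex_midVertex (hpj.trans hjn).ne
    grind
  · simp only [← h, coord_leftVertex] at hpj
    have h1 := dist_midVertex_leftVertex j i
    have h2 := dist_midVertex_leftVertex n i
    rw [SimpleGraph.dist_comm] at h1 h2
    grind
  · simp only [← h, coord_rightVertex] at hpj
    have h1 := dist_midVertex_rightVertex j i
    have h2 := dist_midVertex_rightVertex n i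
    rw [SimpleGraph.dist_comm] at h1 h2
    grind

theorem IsAlmostGeodesicRay.exists_dist_add_dist_eq {T : Set ℝ} {γ : T → ABCD}
    (hγ : IsAlmostGeodesicRay T γ) : ∃ N : ℤ, ∀ t s : T, (N : ℝ) ≤ s → s ≤ t →
      cayleyGraph.dist (γ t) (γ s) + cayleyGraph.dist (γ s) (γ ⟨0, hγ.zero_mem⟩) =
        cayleyGraph.dist (γ t) (γ ⟨0, hγ.zero_mem⟩) := by
  -- With error `1/2`, comparing the pairs `(t, s)` and `(t, t)` puts two integers at distance less
  -- than one.
  obtain ⟨N, hN⟩ := hγ.almost_geodesic (1 / 2) (by norm_num)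
  refine ⟨N, fun t s hs hst => ?_⟩
  have h1 := hN t s hs hst
  have h2 := hN t t (hs.trans hst) le_rfl
  rw [dist_self, zero_add] at h2
  change |(cayleyGraph.dist (γ t) (γ s) : ℝ) + (cayleyGraph.dist (γ s) (γ ⟨0, hγ.zero_mem⟩) : ℝ)
    - t| < 1 / 2 at h1
  change |(cayleyGraph.dist (γ t) (γ ⟨0, hγ.zero_mem⟩) : ℝ) - t| < 1 / 2 at h2
  rw [abs_lt] at h1 h2
  have h3 : (cayleyGraph.dist (γ t) (γ s) : ℝ) + cayleyGraph.dist (γ s) (γ ⟨0, hγ.zero_mem⟩) <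
    cayleyGraph.dist (γ t) (γ ⟨0, hγ.zero_mem⟩) + 1 := by linarith
  have h4 : (cayleyGraph.dist (γ t) (γ ⟨0, hγ.zero_mem⟩) : ℝ) <
    cayleyGraph.dist (γ t) (γ s) + cayleyGraph.dist (γ s) (γ ⟨0, hγ.zero_mem⟩) + 1 := by linarith
  norm_cast at h3 h4
  lia

theorem not_isBusemannPoint_midLimit : ¬ IsBusemannPoint midLimit := by
  rintro ⟨-, T, γ, hγ, hlim⟩
  obtain ⟨N, hN⟩ := hγ.exists_dist_add_dist_eq
  set o : ABCD := γ ⟨0, hγ.zero_mem⟩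
  have : Nonempty T := ⟨⟨0, hγ.zero_mem⟩⟩
  obtain ⟨s₀, hs₀T, hs₀⟩ := not_bddAbove_iff.1 hγ.unbounded N
  -- Large enough to put the gate of `γ s` above the height of `o`, as `dist_midVertex_lt` requires.
  let k := max 1 ((coord o).2.1 + 1)
  obtain ⟨s, ⟨hs1, hs2⟩, hs3⟩ :=
    (((eventually_evalPhi_eq hlim (leftVertex 0) (rightVertex 0)).and
      (eventually_evalPhi_eq hlim (leftVertex k) (leftVertex 0))).and
        (eventually_ge_atTop (⟨s₀, hs₀T⟩ : T))).exists
  have hNs : (N : ℝ) ≤ s := hs₀.le.trans hs3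
  rw [evalPhi_midLimit_rightVertex] at hs1
  rw [evalPhi_midLimit_leftVertex] at hs2
  norm_cast at hs1 hs2
  obtain ⟨p, hp, hps⟩ := exists_mem_strip_coord_eq (γ s)
  rw [dist_eq_dist_add_dist (leftVertex_mem_strip _) hp hps,
    dist_eq_dist_add_dist (rightVertex_mem_strip _) hp hps] at hs1
  rw [dist_eq_dist_add_dist (leftVertex_mem_strip _) hp hps,
    dist_eq_dist_add_dist (leftVertex_mem_strip _) hp hps] at hs2
  obtain ⟨j, hj, rfl⟩ := eq_midVertex_of_dist_eq hp (k := k) (le_max_left _ _)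
    (by lia) (by lia)
  obtain ⟨q, hq, hqo⟩ := exists_mem_strip_coord_eq o
  -- The ray and the middle vertices have the same limit, so additivity through `γ s` transfers from
  -- `γ t` to a far `midVertex n`. The path from `o` through `γ s` and its gate `midVertex j` would
  -- then be minimal, against `h2`.
  obtain ⟨t, ht, hst⟩ :=
    ((eventually_evalPhi_eq hlim o (γ s)).and (eventually_ge_atTop s)).exists
  obtain ⟨n, hn, hjn⟩ := ((eventually_evalPhi_eq tendsto_midLimit o (γ s)).and
    (Nat.hyperfilter_le_atTop (eventually_gt_atTop j.toNat))).exists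
  rw [← ht] at hn
  norm_cast at hn
  have h1 := hN t s hNs hst
  have h2 := dist_midVertex_lt hq hqo (j := j) (n := n)
    (lt_of_lt_of_le (Int.lt_succ _) ((le_max_right _ _).trans hj)) (by lia)
  have h3 := dist_eq_dist_add_dist (midVertex_mem_strip n) hp hps
  have h4 := cayleyGraph_connected.dist_triangle (u := o) (v := γ s) (w := midVertex j)
  rw [SimpleGraph.dist_comm (u := o) (v := midVertex n)] at h2
  rw [SimpleGraph.dist_comm (u := γ s) (v := midVertex n)] at h3
  rw [SimpleGraph.dist_comm (u := o) (v := γ s)] at h4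
  lia

end MetricCompact

theorem mainTheorem11 :
    Group.IsFinitelyPresented ABCD ∧
    (∀ n : ℕ,
      gA * gB ^ n * gA⁻¹ = gD * (gC⁻¹) ^ n * gD⁻¹ ∧
      IsOnlyMinimalPath cayleyGraph gA (gA * gB ^ n * gA⁻¹) (List.replicate n gB ++ [gA⁻¹]) ∧
      IsOnlyMinimalPath cayleyGraph gD (gA * gB ^ n * gA⁻¹) (List.replicate n gC⁻¹ ++ [gD⁻¹]) ∧
      perimeter cayleyGraph gA (gA * gB ^ n * gA⁻¹) gD = 2 * n + 4) ∧
    ∃ ω ∈ metricBoundary ABCD, ¬ IsBusemannPoint ω := by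
  refine ⟨?_, fun n => ?_, midLimit, midLimit_mem_metricBoundary, not_isBusemannPoint_midLimit⟩
  · exact inferInstanceAs (Group.IsFinitelyPresented (PresentedGroup {relator}))
  · have h : gA * gB ^ n * gA⁻¹ = gD * (gC⁻¹) ^ n * gD⁻¹ := by
      rw [gA_mul_gB_pow_mul_gA_inv, gD_mul_gC_inv_pow_mul_gD_inv]
    refine ⟨h, isOnlyMinimalPath_gA n, h ▸ isOnlyMinimalPath_gD n, ?_⟩
    rw [gA_mul_gB_pow_mul_gA_inv, perimeter_gA_midVertex_gD]
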